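/- Let $q>1$ and $m\ge 1$ be fixed integers. For $n\ge m$, an $(n-m)$-dimensional subcube of $\mathbf{Z}_q^n$ is a subset obtained by fixing some $m$ of the $n$ components and letting each of the remaining $n-m$ components run through all values of $\mathbf{Z}_q$. Let $c_q(n,m)$ denote the number of unordered partitions of $\mathbf{Z}_q^n$ into $q^m$ subcubes of dimension $n-m$ (so that each vector of $\mathbf{Z}_q^n$ lies in exactly one subcube). Then $$c_q(n,m)\sim n^{\frac{q^m-1}{q-1}}\qquad (n\to\infty),$$ that is, $c_q(n,m)\big/n^{(q^m-1)/(q-1)}\to 1$ as $n\to\infty$. -/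

import Mathlib

/-- `S` is a `d`-dimensional subcube of the hypercube `ℤ_q^n`: some `n - d` components are fixed
(those in `I`, to the values of `a`), and the remaining `d` components run freely through
`ℤ_q`. -/
def IsSubcube (q n d : ℕ) (S : Set (Fin n → ZMod q)) : Prop :=
  ∃ (I : Finset (Fin n)) (a : Fin n → ZMod q),
    I.card + d = n ∧ S = {x | ∀ i ∈ I, x i = a i}

/-- The set of all unordered partitions of `ℤ_q^n` into exactly `q ^ m` subcubes of dimension
`n - m`. A partition is a set of nonempty subsets such that every vector lies in exactly one
of them. If `n < m`, then `n - m` truncates to `0`, and the set is empty for `2 ≤ q`, as the only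
partition into points has `q ^ n < q ^ m` blocks. -/
def subcubePartitions (q n m : ℕ) : Set (Set (Set (Fin n → ZMod q))) :=
  {P | Setoid.IsPartition P ∧ P.ncard = q ^ m ∧ ∀ S ∈ P, IsSubcube q n (n - m) S}

/-- The number of unordered partitions of `ℤ_q^n` into `q ^ m` subcubes of dimension `n - m`
(a finite number for `q ≠ 0`, since then `ℤ_q^n` is finite). -/
noncomputable def numSubcubePartitions (q n m : ℕ) : ℕ :=
  (subcubePartitions q n m).ncard

/-! Write q = |A| and give a family P of subcubes the deficiency |P| - (q-1)|vars P|. Hall's theorem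
shows that every proper subfamily of an exact cover has strictly smaller deficiency
(`IsExactCover.deficiency_lt`). The empty subfamily has deficiency 0, so a cover by q^m cubes uses
at most N = (q^m-1)/(q-1) coordinates. Covers using fewer than N coordinates number O(n^(N-1)):
choose the coordinates, then one of boundedly many patterns.

Covers using exactly N coordinates have deficiency one. Cutting such a cover along a used coordinate
i and counting cubes and coordinates leaves no slack (`IsExactCover.hyperSlice_balance`): every
slice again has deficiency one, the part free in i has deficiency 0, and different slices share only
coordinates of that free part. Induction then yields a coordinate fixed by all cubes
(`IsExactCover.exists_root`). Splitting there repeatedly exhibits the cover as the leaves of a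
complete q-ary decision tree of depth m with N distinct queries. The tree is determined by the
cover, so there are n(n-1)...(n-N+1) ~ n^N of these. -/

set_option linter.unusedSectionVars false

/-! ### Subcubes as partial assignments, and exact covers -/

section ExactCover

open Finset

variable {ι A : Type*}

/-- The point `x` lies in the subcube described by the partial assignment `c`. -/
def Matches (c : ι → Option A) (x : ι → A) : Prop := ∀ i a, c i = some a → x i = a

theorem exists_matches [Nonempty A] (c : ι → Option A) : ∃ x, Matches c x :=
  ⟨fun i => (c i).getD (Classical.arbitrary A), fun i a h => by simp [h]⟩

/-- Every point lies in exactly one of the subcubes of `P`. -/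
def IsExactCover (P : Finset (ι → Option A)) : Prop :=
  ∀ x : ι → A, ∃! c, c ∈ P ∧ Matches c x

theorem IsExactCover.eq_of_matches {P : Finset (ι → Option A)} (hP : IsExactCover P)
    {c d : ι → Option A} (hc : c ∈ P) (hd : d ∈ P) {x : ι → A} (hcx : Matches c x)
    (hdx : Matches d x) : c = d :=
  (hP x).unique ⟨hc, hcx⟩ ⟨hd, hdx⟩

theorem matches_update_iff [DecidableEq ι] {c : ι → Option A} {i : ι} {v : A}
    (hc : c i = none ∨ c i = some v) (x : ι → A) :
    Matches c (Function.update x i v) ↔ Matches (Function.update c i none) x := by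
  constructor
  · intro h j a hj
    by_cases hji : j = i
    · subst hji; simp at hj
    · rw [Function.update_of_ne hji] at hj
      simpa [Function.update_of_ne hji] using h j a hj
  · intro h j a hj
    by_cases hji : j = i
    · subst hji
      rcases hc with hc | hc <;> simp_all
    · rw [Function.update_of_ne hji]
      exact h j a (by rwa [Function.update_of_ne hji])

variable [Fintype ι] [DecidableEq ι]

/-- The coordinates fixed by a partial assignment. -/
def fixedCoords (c : ι → Option A) : Finset ι := univ.filter fun i => (c i).isSome

theorem mem_fixedCoords {c : ι → Option A} {i : ι} : i ∈ fixedCoords c ↔ c i ≠ none := by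
  simp [fixedCoords, Option.isSome_iff_ne_none]

/-- The coordinates fixed by some member of a family of partial assignments. -/
def vars (P : Finset (ι → Option A)) : Finset ι := P.biUnion fixedCoords

theorem mem_vars {P : Finset (ι → Option A)} {i : ι} : i ∈ vars P ↔ ∃ c ∈ P, c i ≠ none := by
  simp [vars, mem_fixedCoords]

theorem Matches.congr_vars {P : Finset (ι → Option A)} {c : ι → Option A} (hc : c ∈ P)
    {x y : ι → A} (hx : Matches c x) (hxy : ∀ i ∈ vars P, x i = y i) : Matches c y := by
  intro i a h
  rw [← hxy i (mem_vars.2 ⟨c, hc, by simp [h]⟩)]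
  exact hx i a h

/-! ### Deficiency and Hall's theorem -/

variable [Fintype A] [DecidableEq A]

/-- The deficiency of a family of subcubes: its size, minus `|A| - 1` for each coordinate used. -/
def deficiency (P : Finset (ι → Option A)) : ℤ :=
  (#P : ℤ) - ((Fintype.card A : ℤ) - 1) * #(vars P)

/-- Hall's theorem yields a point outside all subcubes of `G`, with prescribed coordinates
in `V`. -/
theorem exists_forall_not_matches (hA : 1 < Fintype.card A) (G : Finset (ι → Option A))
    (V : Finset ι)
    (hG : ∀ s ⊆ G, #s ≤ (Fintype.card A - 1) * #(vars s \ V)) (y : ι → A) :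
    ∃ x : ι → A, (∀ i ∈ V, x i = y i) ∧ ∀ c ∈ G, ¬ Matches c x := by
  classical
  -- Each coordinate outside `V` offers |A| - 1 slots; a matching hands every cube of `G` a
  -- coordinate on which it is to be avoided.
  let t : G → Finset (ι × Fin (Fintype.card A - 1)) :=
    fun c => (fixedCoords c.1 \ V) ×ˢ univ
  have hall : ∀ s : Finset G, #s ≤ #(s.biUnion t) := by
    intro s
    have h1 := hG (s.map (Function.Embedding.subtype _)) (by
      intro c hc
      obtain ⟨d, -, rfl⟩ := mem_map.1 hc
      exact d.2)
    have h2 : s.biUnion t =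
        (vars (s.map (Function.Embedding.subtype _)) \ V) ×ˢ univ := by
      ext ⟨i, k⟩
      simp [t, mem_vars, mem_fixedCoords]
      grind
    rw [h2, card_product, card_univ, Fintype.card_fin, mul_comm]
    simpa using h1
  obtain ⟨g, hg, hgt⟩ := (Finset.all_card_le_biUnion_card_iff_exists_injective t).1 hall
  -- At most |A| - 1 cubes are assigned to `j`, so they cannot forbid all |A| values.
  have hval : ∀ j : ι, ∃ a : A, ∀ c : G, (g c).1 = j → c.1 j ≠ some a := by
    intro j
    by_contra! hcon
    choose f hf hf' using hcon
    have hinj : Function.Injective fun a => (g (f a)).2 := by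
      intro a b hab
      have : f a = f b := hg (Prod.ext ((hf a).trans (hf b).symm) hab)
      have h3 := hf' a
      rw [this, hf' b] at h3
      exact (Option.some.inj h3).symm
    have := Fintype.card_le_of_injective _ hinj
    simp at this
    omega
  choose f hf using hval
  refine ⟨fun i => if i ∈ V then y i else f i, fun i hi => by simp [hi], ?_⟩
  intro c hc hm
  have hmem := hgt ⟨c, hc⟩
  simp only [t, mem_product, mem_sdiff, mem_fixedCoords, mem_univ, and_true] at hmem
  obtain ⟨a, ha⟩ := Option.ne_none_iff_exists'.1 hmem.1
  have h4 := hm _ a ha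
  simp only [hmem.2, if_false] at h4
  exact hf _ ⟨c, hc⟩ rfl (by rw [h4]; exact ha)

/-- Otherwise some proper `M` has maximal deficiency among all subfamilies, which is Hall's
condition for `P \ M` off `vars M`. A point of a cube `c₀` outside `M` can then be changed off `vars
M` to avoid `P \ M`. The cube of `M` covering the new point also covers the old one, against
exactness. -/
theorem IsExactCover.deficiency_lt (hA : 1 < Fintype.card A) {P F : Finset (ι → Option A)}
    (hP : IsExactCover P) (hF : F ⊂ P) : deficiency F < deficiency P := by
  by_contra! hle
  obtain ⟨M, hM, hmax⟩ := exists_max_image P.ssubsets deficiency ⟨F, mem_ssubsets.2 hF⟩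
  rw [mem_ssubsets] at hM
  have hmax' : ∀ G ⊆ P, deficiency G ≤ deficiency M := by
    intro G hG
    rcases hG.eq_or_ssubset with rfl | hG
    · exact hle.trans (hmax F (mem_ssubsets.2 hF))
    · exact hmax G (mem_ssubsets.2 hG)
  obtain ⟨c₀, hc₀, hc₀M⟩ := exists_of_ssubset hM
  have : Nonempty A := Fintype.card_pos_iff.1 (by omega)
  obtain ⟨y, hy⟩ := exists_matches c₀
  obtain ⟨x, hxy, hx⟩ := exists_forall_not_matches hA (P \ M) (vars M) (by
    intro s hs
    have h1 := hmax' (M ∪ s) (union_subset hM.1 (hs.trans sdiff_subset))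
    have h2 : #(M ∪ s) = #M + #s := card_union_of_disjoint
      (disjoint_of_subset_right hs disjoint_sdiff)
    have h3 : vars (M ∪ s) = vars M ∪ (vars s \ vars M) := by
      simp [vars, union_biUnion]
    have h4 : #(vars (M ∪ s)) = #(vars M) + #(vars s \ vars M) := by
      rw [h3, card_union_of_disjoint disjoint_sdiff]
    simp only [deficiency, h2, h4] at h1
    zify [hA.le]
    push_cast at h1
    linarith) y
  obtain ⟨c, ⟨hc, hcx⟩, -⟩ := hP x
  have hcM : c ∈ M := by
    by_contra hcM
    exact hx c (mem_sdiff.2 ⟨hc, hcM⟩) hcx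
  have := hP.eq_of_matches hc hc₀ (hcx.congr_vars hcM hxy) hy
  exact hc₀M (this ▸ hcM)

theorem IsExactCover.nonempty [Nonempty A] {P : Finset (ι → Option A)} (hP : IsExactCover P) :
    P.Nonempty := by
  obtain ⟨c, ⟨hc, -⟩, -⟩ := hP fun _ => Classical.arbitrary A
  exact ⟨c, hc⟩

theorem IsExactCover.one_le_deficiency (hA : 1 < Fintype.card A) {P : Finset (ι → Option A)}
    (hP : IsExactCover P) : 1 ≤ deficiency P := by
  have : Nonempty A := Fintype.card_pos_iff.1 (by omega)
  have := hP.deficiency_lt hA (empty_ssubset.2 hP.nonempty)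
  simp [deficiency, vars] at this ⊢
  linarith

/-! ### Slices along a coordinate -/

/-- The members of `P` that meet the hyperplane `x i = v`, with coordinate `i` freed. -/
def hyperSlice (P : Finset (ι → Option A)) (i : ι) (v : A) : Finset (ι → Option A) :=
  (P.filter fun c => c i = none ∨ c i = some v).image fun c => Function.update c i none

theorem mem_hyperSlice {P : Finset (ι → Option A)} {i : ι} {v : A} {d : ι → Option A} :
    d ∈ hyperSlice P i v ↔
      ∃ c ∈ P, (c i = none ∨ c i = some v) ∧ Function.update c i none = d := by
  simp [hyperSlice, and_assoc]

theorem IsExactCover.isExactCover_hyperSlice {P : Finset (ι → Option A)} (hP : IsExactCover P) (i : ι) (v : A) :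
    IsExactCover (hyperSlice P i v) := by
  intro x
  obtain ⟨c, ⟨hc, hcx⟩, huniq⟩ := hP (Function.update x i v)
  have hci : c i = none ∨ c i = some v := by
    rcases h : c i with _ | a
    · exact Or.inl rfl
    · have := hcx i a h
      simp at this
      simp [this]
  refine ⟨Function.update c i none, ⟨mem_hyperSlice.2 ⟨c, hc, hci, rfl⟩,
    (matches_update_iff hci x).1 hcx⟩, ?_⟩
  rintro d ⟨hd, hdx⟩
  obtain ⟨c', hc', hci', rfl⟩ := mem_hyperSlice.1 hd
  rw [huniq c' ⟨hc', (matches_update_iff hci' x).2 hdx⟩]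

/-- Freeing `i` merges no two cubes: both would contain a common point of the hyperplane. -/
theorem IsExactCover.card_hyperSlice [Nonempty A] {P : Finset (ι → Option A)} (hP : IsExactCover P)
    (i : ι) (v : A) :
    #(hyperSlice P i v) =
      #(P.filter fun c => c i = none) + #(P.filter fun c => c i = some v) := by
  rw [hyperSlice, card_image_of_injOn, filter_or, card_union_of_disjoint]
  · rw [disjoint_filter]
    intro c _ h
    simp [h]
  · intro c hc d hd hcd
    simp only [coe_filter, Set.mem_ofPred_eq] at hc hd
    obtain ⟨x, hx⟩ := exists_matches (Function.update c i none)
    refine hP.eq_of_matches hc.1 hd.1 ((matches_update_iff hc.2 x).2 hx)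
      ((matches_update_iff hd.2 x).2 ?_)
    simp only at hcd
    rwa [← hcd]

theorem mem_vars_hyperSlice {P : Finset (ι → Option A)} {i j : ι} {v : A} :
    j ∈ vars (hyperSlice P i v) ↔
      j ≠ i ∧ ∃ c ∈ P, (c i = none ∨ c i = some v) ∧ c j ≠ none := by
  rw [mem_vars]
  constructor
  · rintro ⟨d, hd, hj⟩
    obtain ⟨c, hc, hci, rfl⟩ := mem_hyperSlice.1 hd
    by_cases hji : j = i
    · simp [hji] at hj
    · exact ⟨hji, c, hc, hci, by rwa [Function.update_of_ne hji] at hj⟩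
  · rintro ⟨hji, c, hc, hci, hj⟩
    exact ⟨_, mem_hyperSlice.2 ⟨c, hc, hci, rfl⟩, by rwa [Function.update_of_ne hji]⟩

theorem vars_free_subset {P : Finset (ι → Option A)} {i : ι} {v : A} :
    vars (P.filter fun c => c i = none) ⊆ vars (hyperSlice P i v) := by
  intro j hj
  obtain ⟨c, hc, hcj⟩ := mem_vars.1 hj
  rw [mem_filter] at hc
  refine mem_vars_hyperSlice.2 ⟨?_, c, hc.1, Or.inl hc.2, hcj⟩
  rintro rfl
  exact hcj hc.2

/-- A cube free in `i` occurs in all |A| slices, any other cube in exactly one. The extra term on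
the left avoids subtraction. -/
theorem sum_card_hyperSlice [Nonempty A] {P : Finset (ι → Option A)} (hP : IsExactCover P) (i : ι) :
    ∑ v, #(hyperSlice P i v) + #(P.filter fun c => c i = none) =
      #P + Fintype.card A * #(P.filter fun c => c i = none) := by
  have h1 : #P = ∑ o : Option A, #(P.filter fun c => c i = o) :=
    card_eq_sum_card_fiberwise fun c _ => by simp
  rw [Fintype.sum_option] at h1
  simp_rw [hP.card_hyperSlice, sum_add_distrib, sum_const, card_univ, smul_eq_mul]
  omega

theorem card_vars_le {P : Finset (ι → Option A)} (i : ι) (E : A → Finset ι)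
    (hE : ∀ c ∈ P, ∀ v, c i = some v → ∀ j ≠ i, c j ≠ none →
      j ∉ vars (P.filter fun c => c i = none) → ∃ w, j ∈ E w) :
    #(vars P) ≤ 1 + #(vars (P.filter fun c => c i = none)) + ∑ v, #(E v) := by
  calc #(vars P) ≤ #({i} ∪ vars (P.filter fun c => c i = none) ∪ univ.biUnion E) := by
        refine card_le_card fun j hj => ?_
        obtain ⟨c, hc, hcj⟩ := mem_vars.1 hj
        simp only [mem_union, mem_singleton, mem_biUnion, mem_univ, true_and]
        by_cases hji : j = i
        · exact Or.inl (Or.inl hji)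
        by_cases hjS : j ∈ vars (P.filter fun c => c i = none)
        · exact Or.inl (Or.inr hjS)
        rcases h : c i with _ | v
        · exact absurd (mem_vars.2 ⟨c, mem_filter.2 ⟨hc, h⟩, hcj⟩) hjS
        · exact Or.inr (hE c hc v h j hji hcj hjS)
    _ ≤ _ := (card_union_le _ _).trans
        (add_le_add ((card_union_le _ _).trans (by simp)) card_biUnion_le)

/-- In a cover of deficiency one, sets `E v` of coordinates new in the slices at `i` that together
reach all coordinates outside `i` and the part free in `i` must be all new coordinates. -/
theorem IsExactCover.hyperSlice_balance (hA : 1 < Fintype.card A) {P : Finset (ι → Option A)}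
    (hP : IsExactCover P) (hd : deficiency P ≤ 1) {i : ι} (hi : i ∈ vars P)
    (E : A → Finset ι)
    (hE : ∀ c ∈ P, ∀ v, c i = some v → ∀ j ≠ i, c j ≠ none →
      j ∉ vars (P.filter fun c => c i = none) → ∃ w, j ∈ E w)
    (hEsub : ∀ v, E v ⊆ vars (hyperSlice P i v) \ vars (P.filter fun c => c i = none)) :
    (∀ v, deficiency (hyperSlice P i v) = 1) ∧
      deficiency (P.filter fun c => c i = none) = 0 ∧
      ∀ v, E v = vars (hyperSlice P i v) \ vars (P.filter fun c => c i = none) := by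
  have : Nonempty A := Fintype.card_pos_iff.1 (by omega)
  set S := P.filter fun c => c i = none with hS
  have hSd : deficiency S ≤ 0 := by
    have : deficiency S < deficiency P := hP.deficiency_lt hA (by
      obtain ⟨c, hc, hci⟩ := mem_vars.1 hi
      exact filter_ssubset.2 ⟨c, hc, hci⟩)
    omega
  have hq : (0 : ℤ) < (Fintype.card A : ℤ) - 1 := by
    have : (1 : ℤ) < Fintype.card A := by exact_mod_cast hA
    linarith
  have h1 : ∀ v, 1 ≤ deficiency (hyperSlice P i v) :=
    fun v => (hP.isExactCover_hyperSlice i v).one_le_deficiency hA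
  have h2 : ∀ v, (#(vars (hyperSlice P i v)) : ℤ) = #(vars S) +
      #(vars (hyperSlice P i v) \ vars S) := fun v => by
    rw [card_sdiff_of_subset vars_free_subset, Nat.cast_sub (card_le_card vars_free_subset)]
    ring
  have h3 : ∀ v, (#(E v) : ℤ) ≤ #(vars (hyperSlice P i v) \ vars S) := fun v => by
    exact_mod_cast card_le_card (hEsub v)
  have h4 : (#(vars P) : ℤ) ≤ 1 + #(vars S) + ∑ v, (#(E v) : ℤ) := by
    exact_mod_cast card_vars_le i E hE
  have h5 : (∑ v, (#(hyperSlice P i v) : ℤ)) + #S = #P + Fintype.card A * #S := by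
    exact_mod_cast sum_card_hyperSlice hP i
  set q : ℤ := (Fintype.card A : ℤ) with hqdef
  have h6 : ∑ v, deficiency (hyperSlice P i v) =
      (∑ v, (#(hyperSlice P i v) : ℤ)) - (q - 1) * (q * #(vars S)) -
        (q - 1) * ∑ v, (#(vars (hyperSlice P i v) \ vars S) : ℤ) := by
    simp_rw [deficiency, h2, sum_sub_distrib, ← mul_sum, sum_add_distrib, sum_const, card_univ,
      nsmul_eq_mul]
    ring
  -- The left side is nonnegative and the right side nonpositive, so every term vanishes.
  have h7 : ∑ v, (deficiency (hyperSlice P i v) - 1) + (q - 1) *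
      ∑ v, ((#(vars (hyperSlice P i v) \ vars S) : ℤ) - #(E v)) ≤
        (q - 1) * deficiency S := by
    have h8 := mul_le_mul_of_nonneg_left h4 hq.le
    have h9 : deficiency S = #S - (q - 1) * #(vars S) := rfl
    have h10 : deficiency P = #P - (q - 1) * #(vars P) := rfl
    rw [sum_sub_distrib, sum_sub_distrib, h6, h9]
    simp only [sum_const, card_univ, nsmul_eq_mul, mul_one, ← hqdef]
    linarith
  have h8 : 0 ≤ ∑ v, (deficiency (hyperSlice P i v) - 1) :=
    sum_nonneg fun v _ => by linarith [h1 v]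
  have h9 : 0 ≤ ∑ v, ((#(vars (hyperSlice P i v) \ vars S) : ℤ) - #(E v)) :=
    sum_nonneg fun v _ => by linarith [h3 v]
  have h10 : (q - 1) * deficiency S ≤ 0 := mul_nonpos_of_nonneg_of_nonpos hq.le hSd
  have h11 := mul_nonneg hq.le h9
  have h12 : ∑ v, (deficiency (hyperSlice P i v) - 1) = 0 := by linarith
  have h13 : (q - 1) * ∑ v, ((#(vars (hyperSlice P i v) \ vars S) : ℤ) - #(E v)) = 0 := by
    linarith
  have h14 : (q - 1) * deficiency S = 0 := by linarith
  refine ⟨fun v => ?_, (mul_eq_zero.1 h14).resolve_left hq.ne', fun v => ?_⟩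
  · have := (sum_eq_zero_iff_of_nonneg fun v _ => by linarith [h1 v]).1 h12 v (mem_univ v)
    linarith
  · have := (sum_eq_zero_iff_of_nonneg fun v _ => by linarith [h3 v]).1
      ((mul_eq_zero.1 h13).resolve_left hq.ne') v (mem_univ v)
    exact eq_of_subset_of_card_le (hEsub v) (by zify; linarith)

theorem IsExactCover.deficiency_hyperSlice (hA : 1 < Fintype.card A) {P : Finset (ι → Option A)}
    (hP : IsExactCover P) (hd : deficiency P ≤ 1) {i : ι} (hi : i ∈ vars P) :
    (∀ v, deficiency (hyperSlice P i v) = 1) ∧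
      deficiency (P.filter fun c => c i = none) = 0 := by
  have := hP.hyperSlice_balance hA hd hi
    (fun v => vars (hyperSlice P i v) \ vars (P.filter fun c => c i = none))
    (fun c hc v hv j hji hcj hj => ⟨v, mem_sdiff.2
      ⟨mem_vars_hyperSlice.2 ⟨hji, c, hc, Or.inr hv, hcj⟩, hj⟩⟩)
    (fun v => Subset.rfl)
  exact ⟨this.1, this.2.1⟩

/-- If `j` were new in both slices, it could be dropped from the new coordinates of slice `v` and
still be reached through slice `w`, contradicting the balance. -/
theorem IsExactCover.mem_vars_free (hA : 1 < Fintype.card A) {P : Finset (ι → Option A)}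
    (hP : IsExactCover P) (hd : deficiency P ≤ 1) {i : ι} (hi : i ∈ vars P) {v w : A}
    (hvw : v ≠ w) {j : ι} (hv : j ∈ vars (hyperSlice P i v))
    (hw : j ∈ vars (hyperSlice P i w)) : j ∈ vars (P.filter fun c => c i = none) := by
  by_contra hj
  set S := P.filter fun c => c i = none
  have := (hP.hyperSlice_balance hA hd hi
    (fun u => if u = v then (vars (hyperSlice P i v) \ vars S).erase j
      else vars (hyperSlice P i u) \ vars S)
    (fun c hc u hu k hki hck hk => by
      by_cases hkj : k = j
      · exact ⟨w, by simp [hvw.symm, hkj, hw, hj]⟩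
      · have : k ∈ vars (hyperSlice P i u) \ vars S := mem_sdiff.2
          ⟨mem_vars_hyperSlice.2 ⟨hki, c, hc, Or.inr hu, hck⟩, hk⟩
        refine ⟨u, ?_⟩
        split_ifs with huv
        · subst huv
          exact mem_erase.2 ⟨hkj, this⟩
        · exact this)
    (fun u => by
      split_ifs with huv
      · subst huv
        exact erase_subset _ _
      · exact Subset.rfl)).2.2 v
  simp only [if_true] at this
  exact (erase_eq_self.1 this) (mem_sdiff.2 ⟨hv, hj⟩)

/-- If every member of a cover of deficiency one fixes `r`, a coordinate other than `r` is used on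
one side of `r` only. -/
theorem IsExactCover.eq_of_root (hA : 1 < Fintype.card A) {P : Finset (ι → Option A)}
    (hP : IsExactCover P) (hd : deficiency P ≤ 1) {r : ι} (hr : ∀ c ∈ P, c r ≠ none)
    {j : ι} (hj : j ≠ r) {c d : ι → Option A} (hc : c ∈ P) (hd' : d ∈ P) (hcj : c j ≠ none)
    (hdj : d j ≠ none) : c r = d r := by
  obtain ⟨v, hv⟩ := Option.ne_none_iff_exists'.1 (hr c hc)
  obtain ⟨w, hw⟩ := Option.ne_none_iff_exists'.1 (hr d hd')
  rw [hv, hw]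
  by_contra hvw
  have := hP.mem_vars_free hA hd (mem_vars.2 ⟨c, hc, hr c hc⟩) (fun h => hvw (congrArg some h))
    (mem_vars_hyperSlice.2 ⟨hj, c, hc, Or.inr hv, hcj⟩)
    (mem_vars_hyperSlice.2 ⟨hj, d, hd', Or.inr hw, hdj⟩)
  obtain ⟨e, he, -⟩ := mem_vars.1 this
  rw [mem_filter] at he
  exact hr e he.1 he.2

/-- An exact cover of deficiency one that is not trivial has a coordinate that all of its members
fix. -/
theorem IsExactCover.exists_root (hA : 1 < Fintype.card A) {P : Finset (ι → Option A)}
    (hP : IsExactCover P) (hd : deficiency P ≤ 1) (hV : (vars P).Nonempty) :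
    ∃ r, ∀ c ∈ P, c r ≠ none := by
  induction hk : #(vars P) using Nat.strong_induction_on generalizing P with
  | _ k ih =>
  have : Nonempty A := Fintype.card_pos_iff.1 (by omega)
  obtain ⟨i, hi⟩ := hV
  obtain ⟨hdv, hSd⟩ := hP.deficiency_hyperSlice hA hd hi
  set S := P.filter fun c => c i = none with hS
  have hq : (0 : ℤ) < (Fintype.card A : ℤ) - 1 := by
    have : (1 : ℤ) < Fintype.card A := by exact_mod_cast hA
    linarith
  have hScard : (#S : ℤ) = ((Fintype.card A : ℤ) - 1) * #(vars S) := by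
    rw [deficiency] at hSd
    linarith
  rcases (vars S).eq_empty_or_nonempty with hSe | hSne
  · refine ⟨i, fun c hc hci => ?_⟩
    have : S = ∅ := by
      rw [← card_eq_zero]
      simpa [hSe] using hScard
    exact notMem_empty c (this ▸ mem_filter.2 ⟨hc, hci⟩)
  -- Each slice has lost `i`, and still has coordinates because it contains `S`.
  have hroot : ∀ v, ∃ r, ∀ c ∈ hyperSlice P i v, c r ≠ none := by
    intro v
    refine ih _ ?_ (hP.isExactCover_hyperSlice i v) (hdv v).le (hSne.mono vars_free_subset) rfl
    rw [← hk]
    refine card_lt_card ⟨?_, fun h => ?_⟩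
    · intro j hj
      obtain ⟨-, c, hc, -, hcj⟩ := mem_vars_hyperSlice.1 hj
      exact mem_vars.2 ⟨c, hc, hcj⟩
    · exact (mem_vars_hyperSlice.1 (h hi)).1 rfl
  choose r hr using hroot
  have hSv : ∀ v, ∀ c ∈ S, c ∈ hyperSlice P i v := by
    intro v c hc
    rw [mem_filter] at hc
    exact mem_hyperSlice.2 ⟨c, hc.1, Or.inl hc.2, by rw [← hc.2, Function.update_eq_self]⟩
  have hri : ∀ v, r v ≠ i := by
    rintro v h
    obtain ⟨c, hc⟩ := (hP.isExactCover_hyperSlice i v).nonempty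
    obtain ⟨c', -, -, rfl⟩ := mem_hyperSlice.1 hc
    exact hr v _ hc (by simp [h])
  obtain ⟨j, hj⟩ := hSne
  obtain ⟨c₀, hc₀, -⟩ := mem_vars.1 hj
  by_cases hall : ∀ v w, r v = r w
  · obtain ⟨v₀⟩ := ‹Nonempty A›
    refine ⟨r v₀, fun c hc => ?_⟩
    obtain ⟨v, hv⟩ : ∃ v, c i = none ∨ c i = some v := by
      rcases c i with _ | v
      · exact ⟨v₀, Or.inl rfl⟩
      · exact ⟨v, Or.inr rfl⟩
    have := hr v _ (mem_hyperSlice.2 ⟨c, hc, hv, rfl⟩)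
    rw [Function.update_of_ne (hri v)] at this
    rwa [hall v₀ v]
  exfalso
  push Not at hall
  obtain ⟨v, w, hvw⟩ := hall
  -- `S` lies in both slices, so its members all fix `r v` and `r w`. Within slice `v`, the
  -- coordinate `r w` occurs on one side of the root `r v` only, so `S` is constant at `r v`;
  -- symmetrically at `r w`.
  have hcv : ∀ c ∈ S, c (r v) = c₀ (r v) := fun c hc =>
    (hP.isExactCover_hyperSlice i v).eq_of_root hA (hdv v).le (hr v) hvw.symm (hSv v c hc) (hSv v c₀ hc₀)
      (hr w c (hSv w c hc)) (hr w c₀ (hSv w c₀ hc₀))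
  have hcw : ∀ c ∈ S, c (r w) = c₀ (r w) := fun c hc =>
    (hP.isExactCover_hyperSlice i w).eq_of_root hA (hdv w).le (hr w) hvw (hSv w c hc) (hSv w c₀ hc₀)
      (hr v c (hSv v c hc)) (hr v c₀ (hSv v c₀ hc₀))
  obtain ⟨b, hb⟩ := Option.ne_none_iff_exists'.1 (hr v c₀ (hSv v c₀ hc₀))
  obtain ⟨b', hb'⟩ := Option.ne_none_iff_exists'.1 (hr w c₀ (hSv w c₀ hc₀))
  have hPv := hP.isExactCover_hyperSlice i v
  have hrv : r v ∈ vars (hyperSlice P i v) :=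
    mem_vars.2 ⟨c₀, hSv v c₀ hc₀, hr v c₀ (hSv v c₀ hc₀)⟩
  have hdvb := (hPv.deficiency_hyperSlice hA (hdv v).le hrv).1 b
  set S' := S.image fun c => Function.update c (r v) none with hS'
  have hS'sub : S' ⊆ hyperSlice (hyperSlice P i v) (r v) b := by
    intro c hc
    obtain ⟨d, hd, rfl⟩ := mem_image.1 hc
    exact mem_hyperSlice.2 ⟨d, hSv v d hd, Or.inr ((hcv d hd).trans hb), rfl⟩
  have hS'card : #S' = #S := by
    refine card_image_of_injOn fun c hc d hd hcd => ?_
    funext k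
    by_cases hkr : k = r v
    · rw [hkr, hcv c hc, hcv d hd]
    · simpa [Function.update_of_ne hkr] using congrFun hcd k
  have hS'vars : #(vars S') + 1 ≤ #(vars S) := by
    have : vars S' ⊂ vars S := by
      refine ⟨fun k hk => ?_, fun h => ?_⟩
      · obtain ⟨c, hc, hck⟩ := mem_vars.1 hk
        obtain ⟨d, hd, rfl⟩ := mem_image.1 hc
        refine mem_vars.2 ⟨d, hd, ?_⟩
        by_cases hkr : k = r v
        · simp [hkr] at hck
        · rwa [Function.update_of_ne hkr] at hck
      · obtain ⟨c, hc, hck⟩ := mem_vars.1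
          (h (mem_vars.2 ⟨c₀, hc₀, hr v c₀ (hSv v c₀ hc₀)⟩))
        obtain ⟨d, hd, rfl⟩ := mem_image.1 hc
        simp at hck
    exact card_lt_card this
  -- Freeing `r v` keeps the size and loses a coordinate, so the deficiency rises from 0 by at least
  -- |A| - 1. This forces `S'` to be the whole slice.
  have hS'd : 1 ≤ deficiency S' := by
    rw [deficiency, hS'card, hScard]
    have : ((#(vars S') : ℤ) + 1) ≤ #(vars S) := by exact_mod_cast hS'vars
    nlinarith
  have hS'eq : S' = hyperSlice (hyperSlice P i v) (r v) b := by
    rcases hS'sub.eq_or_ssubset with h | h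
    · exact h
    · have := (hPv.isExactCover_hyperSlice (r v) b).deficiency_lt hA h
      omega
  -- All of `S'` has value `b'` at `r w`, so a point with another value there is uncovered.
  obtain ⟨b'', hb''⟩ : ∃ b'', b'' ≠ b' := by
    have := Fintype.one_lt_card_iff_nontrivial.1 hA
    exact exists_ne b'
  obtain ⟨c, ⟨hc, hcx⟩, -⟩ := (hPv.isExactCover_hyperSlice (r v) b) fun _ => b''
  rw [← hS'eq] at hc
  obtain ⟨d, hd, rfl⟩ := mem_image.1 hc
  exact hb'' (hcx (r w) b' (by rw [Function.update_of_ne hvw.symm, hcw d hd, hb']))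

end ExactCover

/-! ### Decision trees and their leaves -/

section Trees

open Finset

universe u

/-- The internal nodes of the complete `A`-ary tree of depth `m`: a root, and a copy of the tree
of depth `m - 1` below each of its edges. -/
def TreeNode (A : Type u) : ℕ → Type u
  | 0 => PEmpty
  | m + 1 => Option (A × TreeNode A m)

instance TreeNode.instFintype (A : Type u) [Fintype A] : ∀ m, Fintype (TreeNode A m)
  | 0 => inferInstanceAs (Fintype PEmpty)
  | m + 1 =>
    have := TreeNode.instFintype A m
    inferInstanceAs (Fintype (Option (A × TreeNode A m)))

theorem TreeNode.card_succ (A : Type u) [Fintype A] (m : ℕ) :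
    Fintype.card (TreeNode A (m + 1)) = Fintype.card A * Fintype.card (TreeNode A m) + 1 := by
  rw [← Fintype.card_prod, ← Fintype.card_option]
  exact Fintype.card_congr (Equiv.refl _)

theorem TreeNode.card_mul_pred_add_one (A : Type u) [Fintype A] (hA : 1 < Fintype.card A)
    (m : ℕ) :
    (Fintype.card A - 1) * Fintype.card (TreeNode A m) + 1 = Fintype.card A ^ m := by
  induction m with
  | zero =>
    have : Fintype.card (TreeNode A 0) = 0 := Fintype.card_eq_zero_iff.2 inferInstanceAs
      (IsEmpty PEmpty)
    simp [this]
  | succ m ih =>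
    rw [TreeNode.card_succ, pow_succ, ← ih]
    obtain ⟨p, hp⟩ := Nat.exists_eq_add_of_lt hA
    rw [hp]
    simp only [show 1 + p + 1 - 1 = p + 1 by omega]
    ring

theorem TreeNode.card_eq (A : Type u) [Fintype A] (hA : 1 < Fintype.card A) (m : ℕ) :
    Fintype.card (TreeNode A m) = (Fintype.card A ^ m - 1) / (Fintype.card A - 1) := by
  rw [← TreeNode.card_mul_pred_add_one A hA m, Nat.add_sub_cancel,
    Nat.mul_div_cancel_left _ (by omega)]

variable {ι : Type*} {A : Type u} [Fintype ι] [DecidableEq ι] [Fintype A] [DecidableEq A]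

/-- The subcubes at the leaves of the complete decision tree of depth `m` that queries the
coordinate `f t` at the node `t`. -/
def leafCubes : (m : ℕ) → (TreeNode A m → ι) → Finset (ι → Option A)
  | 0, _ => {fun _ => none}
  | m + 1, f => univ.biUnion fun v : A =>
      (leafCubes m fun t => f (some (v, t))).image fun c => Function.update c (f none) (some v)

theorem mem_leafCubes_succ {m : ℕ} {f : TreeNode A (m + 1) → ι} {d : ι → Option A} :
    d ∈ leafCubes (m + 1) f ↔ ∃ v, ∃ c ∈ leafCubes m fun t => f (some (v, t)),
      Function.update c (f none) (some v) = d := by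
  simp [leafCubes]

theorem mem_range_of_mem_leafCubes {m : ℕ} {f : TreeNode A m → ι} {c : ι → Option A}
    (hc : c ∈ leafCubes m f) {i : ι} (hi : c i ≠ none) : i ∈ Set.range f := by
  induction m generalizing c with
  | zero => simp_all [leafCubes]
  | succ m ih =>
    obtain ⟨v, d, hd, rfl⟩ := mem_leafCubes_succ.1 hc
    by_cases h : i = f none
    · exact ⟨none, h.symm⟩
    · rw [Function.update_of_ne h] at hi
      obtain ⟨t, ht⟩ := ih hd hi
      exact ⟨some (v, t), ht⟩

theorem leafCubes_nonempty [Nonempty A] {m : ℕ} (f : TreeNode A m → ι) :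
    (leafCubes m f).Nonempty := by
  induction m with
  | zero => exact singleton_nonempty _
  | succ m ih =>
    obtain ⟨v⟩ := ‹Nonempty A›
    obtain ⟨c, hc⟩ := ih fun t => f (some (v, t))
    exact ⟨_, mem_leafCubes_succ.2 ⟨v, c, hc, rfl⟩⟩

theorem exists_mem_leafCubes [Nonempty A] {m : ℕ} (f : TreeNode A m → ι) (t : TreeNode A m) :
    ∃ c ∈ leafCubes m f, c (f t) ≠ none := by
  induction m with
  | zero => exact PEmpty.elim t
  | succ m ih =>
    rcases t with _ | ⟨v, t⟩
    · obtain ⟨c, hc⟩ := leafCubes_nonempty f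
      obtain ⟨v, d, hd, rfl⟩ := mem_leafCubes_succ.1 hc
      exact ⟨_, hc, by erw [Function.update_self]; simp⟩
    · obtain ⟨d, hd, hdt⟩ := ih (fun t => f (some (v, t))) t
      refine ⟨_, mem_leafCubes_succ.2 ⟨v, d, hd, rfl⟩, ?_⟩
      by_cases h : f (some (v, t)) = f none
      · rw [h]; simp
      · rwa [Function.update_of_ne h]

theorem mem_vars_leafCubes [Nonempty A] {m : ℕ} {f : TreeNode A m → ι} {i : ι} :
    i ∈ vars (leafCubes m f) ↔ i ∈ Set.range f := by
  rw [mem_vars]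
  constructor
  · rintro ⟨c, hc, hi⟩
    exact mem_range_of_mem_leafCubes hc hi
  · rintro ⟨t, rfl⟩
    exact exists_mem_leafCubes f t

theorem card_vars_leafCubes [Nonempty A] {m : ℕ} {f : TreeNode A m → ι}
    (hf : Function.Injective f) : #(vars (leafCubes m f)) = Fintype.card (TreeNode A m) := by
  rw [← card_univ, ← card_image_of_injective univ hf]
  congr 1
  ext i
  simp [mem_vars_leafCubes]

theorem subtree_injective {m : ℕ} {f : TreeNode A (m + 1) → ι} (hf : Function.Injective f)
    (v : A) : Function.Injective fun t : TreeNode A m => f (some (v, t)) := by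
  intro s t h
  have := Option.some.inj (hf h)
  exact (Prod.ext_iff.1 this).2

theorem root_eq_none_of_mem_leafCubes {m : ℕ} {f : TreeNode A (m + 1) → ι}
    (hf : Function.Injective f) {v : A} {c : ι → Option A}
    (hc : c ∈ leafCubes m fun t => f (some (v, t))) : c (f none) = none := by
  by_contra h
  obtain ⟨t, ht⟩ := mem_range_of_mem_leafCubes hc h
  exact Option.some_ne_none _ (hf ht)

theorem card_fixedCoords_of_mem_leafCubes {m : ℕ} {f : TreeNode A m → ι}
    (hf : Function.Injective f) {c : ι → Option A} (hc : c ∈ leafCubes m f) :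
    #(fixedCoords c) = m := by
  induction m generalizing c with
  | zero => simp_all [leafCubes, fixedCoords]
  | succ m ih =>
    obtain ⟨v, d, hd, rfl⟩ := mem_leafCubes_succ.1 hc
    have hdr := root_eq_none_of_mem_leafCubes hf hd
    have : fixedCoords (Function.update d (f none) (some v)) =
        insert (f none) (fixedCoords d) := by
      ext i
      by_cases h : i = f none
      · subst h; simp [mem_fixedCoords]
      · simp [mem_fixedCoords, h]
    rw [this, card_insert_of_notMem (by simp [mem_fixedCoords, hdr]),
      ih (subtree_injective hf v) hd]

theorem card_leafCubes {m : ℕ} {f : TreeNode A m → ι} (hf : Function.Injective f) :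
    #(leafCubes m f) = Fintype.card A ^ m := by
  induction m with
  | zero => simp [leafCubes]
  | succ m ih =>
    rw [leafCubes, card_biUnion]
    · rw [sum_congr rfl fun v _ => card_image_of_injOn ?_]
      · simp [ih (subtree_injective hf _), pow_succ, mul_comm]
      · intro c hc d hd h
        rw [mem_coe] at hc hd
        funext i
        by_cases hi : i = f none
        · rw [hi, root_eq_none_of_mem_leafCubes hf hc, root_eq_none_of_mem_leafCubes hf hd]
        · simpa [Function.update_of_ne hi] using congrFun h i
    · intro v _ w _ hvw
      refine disjoint_left.2 ?_
      intro d hd hd'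
      obtain ⟨c, -, rfl⟩ := mem_image.1 hd
      obtain ⟨c', -, h⟩ := mem_image.1 hd'
      have := congrFun h (f none)
      simp at this
      exact hvw this.symm

theorem isExactCover_leafCubes {m : ℕ} {f : TreeNode A m → ι} (hf : Function.Injective f) :
    IsExactCover (leafCubes m f) := by
  induction m with
  | zero =>
    intro x
    refine ⟨fun _ => none, ⟨by simp [leafCubes], fun i a h => by simp at h⟩, ?_⟩
    rintro d ⟨hd, -⟩
    simpa [leafCubes] using hd
  | succ m ih =>
    intro x
    have key : ∀ v, ∀ c ∈ leafCubes m (fun t => f (some (v, t))),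
        (Matches (Function.update c (f none) (some v)) x ↔ x (f none) = v ∧ Matches c x) := by
      intro v c hc
      have hcr := root_eq_none_of_mem_leafCubes hf hc
      constructor
      · intro h
        refine ⟨h _ v (by simp), fun i a hi => h i a ?_⟩
        rwa [Function.update_of_ne]
        rintro rfl
        simp [hcr] at hi
      · rintro ⟨h1, h2⟩ i a hi
        by_cases h : i = f none
        · subst h
          simp at hi
          rw [h1, hi]
        · rw [Function.update_of_ne h] at hi
          exact h2 i a hi
    obtain ⟨c, ⟨hc, hcx⟩, huniq⟩ := ih (subtree_injective hf (x (f none))) x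
    refine ⟨_, ⟨mem_leafCubes_succ.2 ⟨_, c, hc, rfl⟩, (key _ c hc).2 ⟨rfl, hcx⟩⟩, ?_⟩
    rintro d ⟨hd, hdx⟩
    obtain ⟨v, c', hc', rfl⟩ := mem_leafCubes_succ.1 hd
    obtain ⟨rfl, hc'x⟩ := (key v c' hc').1 hdx
    rw [huniq c' ⟨hc', hc'x⟩]

theorem hyperSlice_leafCubes {m : ℕ} {f : TreeNode A (m + 1) → ι} (hf : Function.Injective f)
    (v : A) :
    hyperSlice (leafCubes (m + 1) f) (f none) v = leafCubes m fun t => f (some (v, t)) := by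
  have key : ∀ w, ∀ c ∈ leafCubes m (fun t => f (some (w, t))),
      Function.update (Function.update c (f none) (some w)) (f none) none = c := by
    intro w c hc
    rw [Function.update_idem, ← root_eq_none_of_mem_leafCubes hf hc, Function.update_eq_self]
  ext d
  rw [mem_hyperSlice]
  constructor
  · rintro ⟨c, hc, hcv, rfl⟩
    obtain ⟨w, c', hc', rfl⟩ := mem_leafCubes_succ.1 hc
    simp at hcv
    subst hcv
    rwa [key _ c' hc']
  · intro hd
    exact ⟨_, mem_leafCubes_succ.2 ⟨v, d, hd, rfl⟩, by simp, key v d hd⟩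

/-- Any other such coordinate would be queried in every subtree, against injectivity, as there are
at least two. -/
theorem root_eq_of_forall_mem_leafCubes (hA : 1 < Fintype.card A) {m : ℕ}
    {f : TreeNode A (m + 1) → ι} (hf : Function.Injective f) {r : ι}
    (hr : ∀ c ∈ leafCubes (m + 1) f, c r ≠ none) : r = f none := by
  by_contra h
  have : Nonempty A := Fintype.card_pos_iff.1 (by omega)
  have key : ∀ v, ∃ t : TreeNode A m, f (some (v, t)) = r := by
    intro v
    obtain ⟨c, hc⟩ := leafCubes_nonempty fun t => f (some (v, t))
    have := hr _ (mem_leafCubes_succ.2 ⟨v, c, hc, rfl⟩)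
    rw [Function.update_of_ne h] at this
    exact mem_range_of_mem_leafCubes hc this
  have := Fintype.one_lt_card_iff_nontrivial.1 hA
  obtain ⟨v, w, hvw⟩ := exists_pair_ne A
  obtain ⟨s, hs⟩ := key v
  obtain ⟨t, ht⟩ := key w
  have := Option.some.inj (hf (hs.trans ht.symm))
  exact hvw (Prod.ext_iff.1 this).1

/-- The root is the only coordinate fixed by all leaves, and the slices at the root are the leaf
families of the subtrees. -/
theorem leafCubes_injOn (hA : 1 < Fintype.card A) {m : ℕ} {f g : TreeNode A m → ι}
    (hf : Function.Injective f) (hg : Function.Injective g)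
    (h : leafCubes m f = leafCubes m g) : f = g := by
  induction m with
  | zero => funext t; exact PEmpty.elim t
  | succ m ih =>
    have hroot : f none = g none := by
      refine root_eq_of_forall_mem_leafCubes hA hg fun c hc => ?_
      rw [← h] at hc
      obtain ⟨v, d, -, rfl⟩ := mem_leafCubes_succ.1 hc
      simp
    funext t
    rcases t with _ | ⟨v, t⟩
    · exact hroot
    · refine congrFun (ih (subtree_injective hf v) (subtree_injective hg v) ?_) t
      rw [← hyperSlice_leafCubes hf, ← hyperSlice_leafCubes hg, h, hroot]

/-- An exact cover of deficiency one by subcubes of codimension `m` consists of the leaves of a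
complete decision tree that queries each coordinate at most once. -/
theorem IsExactCover.exists_leafCubes_eq (hA : 1 < Fintype.card A) {m : ℕ}
    {P : Finset (ι → Option A)} (hP : IsExactCover P) (hd : deficiency P ≤ 1)
    (hm : ∀ c ∈ P, #(fixedCoords c) = m) :
    ∃ f : TreeNode A m → ι, Function.Injective f ∧ leafCubes m f = P := by
  have hne : Nonempty A := Fintype.card_pos_iff.1 (by omega)
  induction m generalizing P with
  | zero =>
    refine ⟨PEmpty.elim, fun t => PEmpty.elim t, ?_⟩
    have h : ∀ c ∈ P, c = fun _ => none := by
      intro c hc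
      funext i
      by_contra hi
      have := mem_fixedCoords.2 hi
      rw [card_eq_zero.1 (hm c hc)] at this
      simp at this
    exact (eq_singleton_iff_nonempty_unique_mem.2 ⟨hP.nonempty, h⟩).symm
  | succ m ih =>
    obtain ⟨c₀, hc₀⟩ := hP.nonempty
    obtain ⟨i, hi⟩ := card_pos.1 (by rw [hm c₀ hc₀]; omega : 0 < #(fixedCoords c₀))
    obtain ⟨r, hr⟩ := hP.exists_root hA hd ⟨i, mem_biUnion.2 ⟨c₀, hc₀, hi⟩⟩
    have hrV : r ∈ vars P := mem_vars.2 ⟨c₀, hc₀, hr c₀ hc₀⟩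
    have hslice : ∀ v, ∀ d, d ∈ hyperSlice P r v ↔
        ∃ c ∈ P, c r = some v ∧ Function.update c r none = d := by
      intro v d
      rw [mem_hyperSlice]
      constructor
      · rintro ⟨c, hc, hcr, h⟩
        exact ⟨c, hc, hcr.resolve_left (hr c hc), h⟩
      · rintro ⟨c, hc, hcr, h⟩
        exact ⟨c, hc, Or.inr hcr, h⟩
    have key : ∀ v, ∃ f : TreeNode A m → ι, Function.Injective f ∧
        leafCubes m f = hyperSlice P r v := by
      intro v
      refine ih (hP.isExactCover_hyperSlice r v) ((hP.deficiency_hyperSlice hA hd hrV).1 v).le ?_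
      intro d hd
      obtain ⟨c, hc, hcr, rfl⟩ := (hslice v d).1 hd
      have : fixedCoords (Function.update c r none) = (fixedCoords c).erase r := by
        ext j
        by_cases hj : j = r
        · subst hj; simp [mem_fixedCoords]
        · simp [mem_fixedCoords, hj]
      rw [this, card_erase_of_mem (mem_fixedCoords.2 (hr c hc)), hm c hc, Nat.add_sub_cancel]
    choose g hg hgP using key
    have hgV : ∀ v t, g v t ∈ vars (hyperSlice P r v) := by
      intro v t
      rw [← hgP, mem_vars_leafCubes]
      exact ⟨t, rfl⟩
    have hgr : ∀ v t, g v t ≠ r := fun v t => (mem_vars_hyperSlice.1 (hgV v t)).1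
    let f : TreeNode A (m + 1) → ι := fun o => Option.elim o r fun p => g p.1 p.2
    refine ⟨f, ?_, ?_⟩
    · rintro (_ | ⟨v, s⟩) (_ | ⟨w, t⟩) h
      · rfl
      · exact absurd h.symm (hgr w t)
      · exact absurd h (hgr v s)
      · have h' : g v s = g w t := h
        -- A query shared by two subtrees would be a coordinate of the part free in `r`, which is
        -- empty.
        obtain rfl : v = w := by
          by_contra hvw
          have := hP.mem_vars_free hA hd hrV hvw (hgV v s) (h' ▸ hgV w t)
          obtain ⟨c, hc, -⟩ := mem_vars.1 this
          rw [mem_filter] at hc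
          exact hr c hc.1 hc.2
        rw [hg v h']
    · ext d
      rw [mem_leafCubes_succ]
      change (∃ v, ∃ c ∈ leafCubes m (g v), Function.update c r (some v) = d) ↔ _
      simp_rw [hgP, hslice]
      constructor
      · rintro ⟨v, _, ⟨c, hc, hcr, rfl⟩, rfl⟩
        rwa [Function.update_idem, ← hcr, Function.update_eq_self]
      · intro hd'
        obtain ⟨v, hv⟩ := Option.ne_none_iff_exists'.1 (hr d hd')
        exact ⟨v, _, ⟨d, hd', hv, rfl⟩, by
          rw [Function.update_idem, ← hv, Function.update_eq_self]⟩

/-! ### Counting covers by the number of coordinates used -/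

/-- The exact covers by `|A| ^ m` subcubes of codimension `m`. -/
def uniformCovers (ι : Type*) (A : Type u) [Fintype ι] [Fintype A] (m : ℕ) :
    Set (Finset (ι → Option A)) :=
  {P | IsExactCover P ∧ #P = Fintype.card A ^ m ∧ ∀ c ∈ P, #(fixedCoords c) = m}

theorem card_vars_le_of_mem_uniformCovers (hA : 1 < Fintype.card A) {m : ℕ}
    {P : Finset (ι → Option A)} (hP : P ∈ uniformCovers ι A m) :
    #(vars P) ≤ Fintype.card (TreeNode A m) := by
  have h := hP.1.one_le_deficiency hA
  rw [deficiency, hP.2.1, ← TreeNode.card_mul_pred_add_one A hA m, Nat.cast_add, Nat.cast_mul,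
    Nat.cast_sub hA.le] at h
  push_cast at h
  have hq : (1 : ℤ) < Fintype.card A := by exact_mod_cast hA
  have : (#(vars P) : ℤ) ≤ Fintype.card (TreeNode A m) :=
    le_of_mul_le_mul_left (by linarith) (sub_pos.2 hq)
  exact_mod_cast this

theorem ncard_uniformCovers_max (hA : 1 < Fintype.card A) (m : ℕ) :
    {P ∈ uniformCovers ι A m | #(vars P) = Fintype.card (TreeNode A m)}.ncard =
      (Fintype.card ι).descFactorial (Fintype.card (TreeNode A m)) := by
  classical
  have hne : Nonempty A := Fintype.card_pos_iff.1 (by omega)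
  have h : (Set.univ : Set (TreeNode A m ↪ ι)).ncard =
      (Fintype.card ι).descFactorial (Fintype.card (TreeNode A m)) := by
    rw [Set.ncard_univ, Nat.card_eq_fintype_card, Fintype.card_embedding_eq]
  rw [← h]
  symm
  refine Set.ncard_congr (fun (f : TreeNode A m ↪ ι) _ => leafCubes m f) ?_ ?_ ?_
  · intro f _
    exact ⟨⟨isExactCover_leafCubes f.injective, card_leafCubes f.injective,
      fun c => card_fixedCoords_of_mem_leafCubes f.injective⟩, card_vars_leafCubes f.injective⟩
  · intro f g _ _ h
    exact DFunLike.coe_injective (leafCubes_injOn hA f.injective g.injective h)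
  · rintro P ⟨⟨hP, hcard, hm⟩, hV⟩
    obtain ⟨f, hf, rfl⟩ := hP.exists_leafCubes_eq hA (by
      rw [deficiency, hcard, hV, ← TreeNode.card_mul_pred_add_one A hA m, Nat.cast_add,
        Nat.cast_mul, Nat.cast_sub hA.le]
      push_cast
      linarith) hm
    exact ⟨⟨f, hf⟩, trivial, rfl⟩

/-- Every family that uses at most `k` coordinates comes from a family on `k` coordinates. -/
theorem ncard_card_vars_le [Nonempty ι] (k : ℕ) :
    {P : Finset (ι → Option A) | #(vars P) ≤ k}.ncard ≤
      Fintype.card (Finset (Fin k → Option A)) * Fintype.card ι ^ k := by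
  classical
  let F : Finset (Fin k → Option A) × (Fin k → ι) → Finset (ι → Option A) :=
    fun p => p.1.image fun d => Function.extend p.2 d fun _ => none
  have hsub : {P : Finset (ι → Option A) | #(vars P) ≤ k} ⊆ F '' Set.univ := by
    intro P hP
    obtain ⟨g⟩ : Nonempty (vars P ↪ Fin k) :=
      Function.Embedding.nonempty_of_card_le (by simpa using hP)
    -- `f` need only hit all of `vars P`; surplus indices get an arbitrary coordinate, and `f` may
    -- fail to be injective.
    let f : Fin k → ι := Function.extend g Subtype.val fun _ => Classical.arbitrary ι
    have hf : ∀ i ∈ vars P, ∃ j, f j = i := fun i hi =>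
      ⟨g ⟨i, hi⟩, g.injective.extend_apply _ _ ⟨i, hi⟩⟩
    refine ⟨(P.image fun c => c ∘ f, f), trivial, ?_⟩
    have key : ∀ c ∈ P, Function.extend f (c ∘ f) (fun _ => none) = c := by
      intro c hc
      funext i
      by_cases hi : ∃ j, f j = i
      · rw [Function.extend_def, dif_pos hi, Function.comp_apply, Classical.choose_spec hi]
      · rw [Function.extend_apply' _ _ _ hi]
        by_contra h
        exact hi (hf i (mem_vars.2 ⟨c, hc, fun h' => h h'.symm⟩))
    simp only [F, image_image]
    exact (image_congr fun c hc => key c hc).trans image_id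
  calc _ ≤ (F '' Set.univ).ncard := Set.ncard_le_ncard hsub (Set.toFinite _)
    _ ≤ (Set.univ : Set (Finset (Fin k → Option A) × (Fin k → ι))).ncard :=
        Set.ncard_image_le (Set.toFinite _)
    _ = _ := by
        rw [Set.ncard_univ, Nat.card_eq_fintype_card, Fintype.card_prod,
          Fintype.card_fun, Fintype.card_fin]

end Trees

/-! ### From partial assignments to sets of points -/

section Translation

open Finset

variable {ι A : Type*}

/-- The set of points of the subcube described by a partial assignment. -/
def cubeSet (c : ι → Option A) : Set (ι → A) := {x | Matches c x}

/-- If `d` left `i` free, changing that coordinate of a point of `d` would leave the cube of `c`. -/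
theorem eq_some_of_cubeSet_subset [Nontrivial A] {c d : ι → Option A}
    (h : cubeSet d ⊆ cubeSet c) {i : ι} {a : A} (hi : c i = some a) : d i = some a := by
  classical
  obtain ⟨x, hx⟩ := exists_matches d
  rcases hd : d i with _ | b
  · obtain ⟨b, hb⟩ := exists_ne a
    have hx' : Function.update x i b ∈ cubeSet d := by
      intro j e hj
      rw [Function.update_of_ne]
      · exact hx j e hj
      · rintro rfl
        simp [hd] at hj
    exact absurd (by simpa using h hx' i a hi) hb
  · rw [← hx i b hd, ← h hx i a hi]

theorem cubeSet_injective [Nontrivial A] :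
    Function.Injective (cubeSet : (ι → Option A) → Set (ι → A)) := by
  intro c d h
  funext i
  rcases hc : c i with _ | a
  · rcases hd : d i with _ | b
    · rfl
    · rw [eq_some_of_cubeSet_subset h.le hd] at hc
      simp at hc
  · rw [eq_some_of_cubeSet_subset h.ge hc]

theorem isSubcube_iff {q n d : ℕ} {S : Set (Fin n → ZMod q)} :
    IsSubcube q n d S ↔ ∃ c : Fin n → Option (ZMod q), #(fixedCoords c) + d = n ∧
      cubeSet c = S := by
  constructor
  · rintro ⟨I, a, hI, rfl⟩
    refine ⟨fun i => if i ∈ I then some (a i) else none, ?_, ?_⟩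
    · convert hI using 3
      ext i
      simp [mem_fixedCoords]
    · ext x
      simp only [cubeSet, Matches, Set.mem_ofPred_eq]
      constructor
      · intro h i hi
        exact h i (a i) (if_pos hi)
      · intro h i a' hi
        split_ifs at hi with hiI
        rw [h i hiI, Option.some.inj hi]
  · rintro ⟨c, hc, rfl⟩
    obtain ⟨a, ha⟩ : ∃ a : Fin n → ZMod q, Matches c a := exists_matches c
    refine ⟨fixedCoords c, a, hc, ?_⟩
    ext x
    simp only [cubeSet, Set.mem_ofPred_eq]
    constructor
    · intro hx i hi
      obtain ⟨b, hb⟩ := Option.ne_none_iff_exists'.1 (mem_fixedCoords.1 hi)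
      rw [hx i b hb, ha i b hb]
    · intro hx i b hb
      rw [hx i (mem_fixedCoords.2 (by simp [hb])), ha i b hb]

theorem subcubePartitions_eq_image {q n m : ℕ} [NeZero q] (hq : 1 < q) (hmn : m ≤ n) :
    subcubePartitions q n m =
      (fun Q : Finset (Fin n → Option (ZMod q)) => cubeSet '' (Q : Set (Fin n → Option (ZMod q))))
        '' uniformCovers (Fin n) (ZMod q) m := by
  classical
  have : Fact (1 < q) := ⟨hq⟩
  have hcover : ∀ Q : Finset (Fin n → Option (ZMod q)),
      IsExactCover Q ↔
        Setoid.IsPartition (cubeSet '' (Q : Set (Fin n → Option (ZMod q)))) := by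
    intro Q
    have hempty : ∅ ∉ cubeSet '' (Q : Set (Fin n → Option (ZMod q))) := by
      rintro ⟨c, -, hc⟩
      obtain ⟨x, hx⟩ := exists_matches c
      exact hc.le hx
    simp only [Setoid.IsPartition, hempty, not_false_eq_true, true_and]
    refine forall_congr' fun x => ⟨?_, ?_⟩
    · rintro ⟨c, ⟨hc, hcx⟩, huniq⟩
      refine ⟨cubeSet c, ⟨⟨c, hc, rfl⟩, hcx⟩, ?_⟩
      rintro _ ⟨⟨d, hd, rfl⟩, hdx⟩
      rw [huniq d ⟨hd, hdx⟩]
    · rintro ⟨_, ⟨⟨c, hc, rfl⟩, hcx⟩, huniq⟩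
      refine ⟨c, ⟨hc, hcx⟩, ?_⟩
      rintro d ⟨hd, hdx⟩
      exact cubeSet_injective (huniq _ ⟨⟨d, hd, rfl⟩, hdx⟩)
  have hncard : ∀ Q : Finset (Fin n → Option (ZMod q)),
      (cubeSet '' (Q : Set (Fin n → Option (ZMod q)))).ncard = #Q := by
    intro Q
    rw [Set.ncard_image_of_injective _ cubeSet_injective, Set.ncard_coe_finset]
  ext P
  constructor
  · rintro ⟨hP, hcard, hsub⟩
    obtain ⟨Q, rfl⟩ : ∃ Q : Finset (Fin n → Option (ZMod q)),
        cubeSet '' (Q : Set (Fin n → Option (ZMod q))) = P := by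
      refine ⟨univ.filter fun c => cubeSet c ∈ P, ?_⟩
      ext S
      constructor
      · rintro ⟨c, hc, rfl⟩
        simpa using hc
      · intro hS
        obtain ⟨c, -, rfl⟩ := isSubcube_iff.1 (hsub S hS)
        exact ⟨c, by simpa using hS, rfl⟩
    refine ⟨Q, ⟨(hcover Q).2 hP, by rw [ZMod.card, ← hncard, hcard], fun c hc => ?_⟩, rfl⟩
    obtain ⟨d, hd, hdc⟩ := isSubcube_iff.1 (hsub _ ⟨c, hc, rfl⟩)
    obtain rfl := cubeSet_injective hdc
    omega
  · rintro ⟨Q, ⟨hQ, hcard, hm⟩, rfl⟩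
    refine ⟨(hcover Q).1 hQ, by rw [hncard, hcard, ZMod.card], ?_⟩
    rintro _ ⟨c, hc, rfl⟩
    exact isSubcube_iff.2 ⟨c, by rw [hm c hc]; omega, rfl⟩

theorem numSubcubePartitions_eq_ncard {q n m : ℕ} [NeZero q] (hq : 1 < q) (hmn : m ≤ n) :
    numSubcubePartitions q n m = (uniformCovers (Fin n) (ZMod q) m).ncard := by
  have : Fact (1 < q) := ⟨hq⟩
  rw [numSubcubePartitions, subcubePartitions_eq_image hq hmn, Set.ncard_image_of_injective]
  intro Q R h
  exact coe_injective (cubeSet_injective.image_injective h)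

theorem exists_numSubcubePartitions_eq {q m : ℕ} (hq : 1 < q) (hm : 1 ≤ m) :
    ∃ C : ℕ, ∀ n, m ≤ n → ∃ r, r ≤ C * n ^ ((q ^ m - 1) / (q - 1) - 1) ∧
      numSubcubePartitions q n m = n.descFactorial ((q ^ m - 1) / (q - 1)) + r := by
  have : NeZero q := ⟨by omega⟩
  have hA : 1 < Fintype.card (ZMod q) := by rwa [ZMod.card]
  have hN : Fintype.card (TreeNode (ZMod q) m) = (q ^ m - 1) / (q - 1) := by
    rw [TreeNode.card_eq _ hA, ZMod.card]
  have hN1 : 0 < Fintype.card (TreeNode (ZMod q) m) := by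
    obtain ⟨k, rfl⟩ := Nat.exists_eq_add_of_le' hm
    rw [TreeNode.card_succ]
    omega
  rw [← hN]
  set N := Fintype.card (TreeNode (ZMod q) m)
  -- The constant counts the families on `N - 1` abstract coordinates; the remainder `r` counts
  -- covers using fewer than `N` coordinates.
  refine ⟨Fintype.card (Finset (Fin (N - 1) → Option (ZMod q))), fun n hn => ?_⟩
  have : Nonempty (Fin n) := ⟨⟨0, by omega⟩⟩
  refine ⟨{P ∈ uniformCovers (Fin n) (ZMod q) m | #(vars P) < N}.ncard, ?_, ?_⟩
  · refine (Set.ncard_le_ncard ?_ (Set.toFinite _)).trans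
      ((ncard_card_vars_le (ι := Fin n) (A := ZMod q) (N - 1)).trans_eq (by rw [Fintype.card_fin]))
    rintro P ⟨-, hP⟩
    exact Nat.le_sub_one_of_lt hP
  · have h := ncard_uniformCovers_max (ι := Fin n) hA m
    rw [Fintype.card_fin] at h
    rw [numSubcubePartitions_eq_ncard hq hn, ← h, ← Set.ncard_union_eq]
    · congr 1
      ext P
      constructor
      · intro hP
        exact (card_vars_le_of_mem_uniformCovers hA hP).eq_or_lt.imp (⟨hP, ·⟩) (⟨hP, ·⟩)
      · rintro (hP | hP) <;> exact hP.1
    · rw [Set.disjoint_left]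
      rintro P ⟨-, h1⟩ ⟨-, h2⟩
      exact h2.ne h1

end Translation

/-! ### The asymptotic formula -/

theorem mainTheorem1 (q m : ℕ) (hq : 1 < q) (hm : 1 ≤ m) :
    Asymptotics.IsEquivalent Filter.atTop
      (fun n : ℕ => (numSubcubePartitions q n m : ℝ))
      (fun n : ℕ => (n : ℝ) ^ ((q ^ m - 1) / (q - 1))) := by
  obtain ⟨C, hC⟩ := exists_numSubcubePartitions_eq hq hm
  have hN : 0 < (q ^ m - 1) / (q - 1) := by
    refine Nat.div_pos (Nat.sub_le_sub_right ?_ 1) (by omega)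
    exact Nat.le_self_pow (by omega) q
  set N := (q ^ m - 1) / (q - 1)
  have hlittle : (fun n : ℕ => (n : ℝ) ^ (N - 1)) =o[Filter.atTop] fun n : ℕ => (n : ℝ) ^ N :=
    (Asymptotics.isLittleO_pow_pow_atTop_of_lt (by omega)).comp_tendsto
      tendsto_natCast_atTop_atTop
  have hdiff : (fun n : ℕ => (numSubcubePartitions q n m : ℝ) - n.descFactorial N)
      =O[Filter.atTop] fun n : ℕ => (n : ℝ) ^ (N - 1) := by
    refine Asymptotics.IsBigO.of_bound C ?_
    filter_upwards [Filter.eventually_ge_atTop m] with n hn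
    obtain ⟨r, hr, h⟩ := hC n hn
    rw [h, Nat.cast_add, add_sub_cancel_left, Real.norm_of_nonneg (by positivity),
      Real.norm_of_nonneg (by positivity)]
    exact_mod_cast hr
  have := (isEquivalent_descFactorial N).add_isLittleO (hdiff.trans_isLittleO hlittle)
  refine this.congr_left (Filter.Eventually.of_forall fun n => ?_)
  simp
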